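/- Let $\Bbbk$ be an algebraically closed field of characteristic zero, $A$ a Hopf algebra over $\Bbbk$, $\sigma$ an algebra automorphism of $A$ and $A[x,\sigma]$ the Ore extension, i.e. the algebra of polynomials $\sum_i a_i x^i$ ($a_i\in A$) with multiplication determined by $xa=\sigma(a)x$. Suppose that $A[x,\sigma]$ is a Hopf-Ore extension of $A$: it carries a Hopf algebra structure that extends the one of $A$ and satisfies $\Delta(x)=x\otimes 1+g\otimes x$ for a grouplike element $g\in A$. Let $\chi=\varepsilon\circ\sigma\colon A\to\Bbbk$; it is the unique character of $A$ with $\sigma(a)=\chi(a_1)a_2$ for all $a\in A$ (and then also $\sigma(a)=ga_1g^{-1}\chi(a_2)$). Assume that $q=\chi(g)$ is a primitive $d$-th root of unity, where $d\ge 1$. A (left) partial action of a bialgebra $\mathcal H$ on a unital algebra $R$ is a linear map $\cdot\colon\mathcal H\otimes R\to R$ such that $1\cdot r=r$, $h\cdot(rs)=(h_1\cdot r)(h_2\cdot s)$ and $h\cdot(k\cdot r)=(h_1\cdot 1_R)(h_2k\cdot r)$ for all $h,k\in\mathcal H$ and $r,s\in R$. Let $\cdot\colon A[x,\sigma]\otimes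 R\to R$ be a partial action on a unital $\Bbbk$-algebra $R$ such that one of the following holds: (i) $g\cdot 1_R=1_R$ and the $d$-th power of the linear map $r\mapsto x\cdot r$ on $R$ is zero; or (ii) $g\cdot 1_R=0$ and $x\cdot 1_R=0$; or (iii) $g\cdot 1_R=0$, $g^d\cdot 1_R=1_R$ and $(x\cdot 1_R)^d\,r=(g^d\cdot r)(x\cdot 1_R)^d$ for all $r\in R$. Let $I=\langle x^d\rangle$ be the two-sided ideal of $A[x,\sigma]$ generated by $x^d$. Then $h\cdot r=0$ for all $h\in I$ and $r\in R$. Moreover, $I$ is a Hopf ideal, and $\cdot$ induces a partial action of the quotient Hopf algebra $A[x,\sigma]/I$ on $R$, i.e. there is a partial action of $A[x,\sigma]/I$ on $R$ with $\overline{h}\cdot r=h\cdot r$ for all $h\in A[x,\sigma]$ and $r\in R$. -/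

import Mathlib

open scoped TensorProduct

/-! ## The Ore extension `A[x, σ]` (with zero derivation) -/

section Ore

variable {k A : Type*} [CommSemiring k] [Ring A] [Algebra k A]

/-- The action of the monoid `(ℕ, +)` on `A` by the powers of the automorphism `σ`. -/
@[reducible]
def oreAction (σ : A ≃ₐ[k] A) : MulSemiringAction (Multiplicative ℕ) A :=
  MulSemiringAction.compHom A (powersHom (A ≃ₐ[k] A) σ)

/-- The Ore extension `A[x, σ]`: skew polynomials `∑ aᵢ xⁱ` with coefficients in `A`, multiplied
according to the rule `x a = σ(a) x`. -/
def OreExtension {k A : Type*} [CommSemiring k] [Ring A] [Algebra k A] (_σ : A ≃ₐ[k] A) :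
    Type _ :=
  SkewPolynomial A

namespace OreExtension

noncomputable instance instRing (σ : A ≃ₐ[k] A) : Ring (OreExtension σ) :=
  letI := oreAction σ
  inferInstanceAs (Ring (SkewPolynomial A))

/-- The inclusion `A → A[x, σ]`. -/
noncomputable def C (σ : A ≃ₐ[k] A) : A →+* OreExtension σ :=
  letI := oreAction σ
  (SkewPolynomial.CRingHom : A →+* SkewPolynomial A)

/-- The variable `x` of `A[x, σ]`. -/
noncomputable def X (σ : A ≃ₐ[k] A) : OreExtension σ :=
  (SkewPolynomial.X : SkewPolynomial A)

/-- The coefficient of `xⁿ`, when the coefficients are written on the left. -/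
noncomputable def coeff (σ : A ≃ₐ[k] A) (n : ℕ) : OreExtension σ →+ A where
  toFun p := SkewPolynomial.coeff p n
  map_zero' := SkewPolynomial.coeff_zero n
  map_add' p q := SkewPolynomial.coeff_add p q n

/-- The defining relation `x a = σ(a) x`. -/
theorem X_mul_C (σ : A ≃ₐ[k] A) (a : A) : X σ * C σ a = C σ (σ a) * X σ := by
  let := oreAction σ
  have h : (SkewPolynomial.X * SkewPolynomial.monomial 0 a : SkewPolynomial A) =
      SkewPolynomial.monomial 0 (σ a) * SkewPolynomial.X := by
    rw [SkewPolynomial.X_mul_monomial, SkewPolynomial.monomial_mul_X]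
    rfl
  exact h

theorem C_mul_X_pow (σ : A ≃ₐ[k] A) (a : A) (n : ℕ) :
    C σ a * X σ ^ n = (SkewPolynomial.monomial n a : SkewPolynomial A) := by
  let := oreAction σ
  exact SkewPolynomial.C_mul_X_pow_eq_monomial (R := A) (a := a) (n := n)

theorem coeff_C_mul_X_pow (σ : A ≃ₐ[k] A) (a : A) (m n : ℕ) :
    coeff σ n (C σ a * X σ ^ m) = if m = n then a else 0 := by
  rw [C_mul_X_pow]
  exact SkewPolynomial.coeff_monomial

theorem coeff_C_mul (σ : A ≃ₐ[k] A) (a : A) (p : OreExtension σ) (n : ℕ) :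
    coeff σ n (C σ a * p) = a * coeff σ n p := by
  let := oreAction σ
  have h : ∀ p : SkewPolynomial A, SkewPolynomial.coeff (SkewPolynomial.monomial 0 a * p) n =
      a * SkewPolynomial.coeff p n := by
    intro p
    induction p using SkewPolynomial.induction with
    | h0 => rw [mul_zero]; simp
    | ha m r q _ _ ih =>
      rw [mul_add, SkewPolynomial.coeff_add, ih, SkewPolynomial.coeff_add, mul_add,
        SkewPolynomial.monomial_mul_monomial]
      simp [SkewPolynomial.coeff_monomial]
  exact h p

/-- Every element of `A[x, σ]` is uniquely of the form `∑ aᵢ xⁱ`. -/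
theorem existsUnique_sum (σ : A ≃ₐ[k] A) (p : OreExtension σ) :
    ∃! f : ℕ →₀ A, p = f.sum fun n a => C σ a * X σ ^ n := by
  have key : ∀ (f : ℕ →₀ A) (n : ℕ), coeff σ n (f.sum fun n a => C σ a * X σ ^ n) = f n := by
    intro f n
    rw [Finsupp.sum, map_sum]
    simp only [coeff_C_mul_X_pow]
    simp
  refine ⟨Finsupp.ofSupportFinite (fun n => coeff σ n p) ?_, ?_, ?_⟩
  · refine (SkewPolynomial.support (R := A) p).finite_toSet.subset ?_
    intro n hn
    exact SkewPolynomial.mem_support_iff.2 hn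
  · refine SkewPolynomial.ext (R := A) fun n => ?_
    exact (key (Finsupp.ofSupportFinite (fun n => coeff σ n p) _) n).symm
  · intro f hf
    ext n
    rw [hf]
    exact (key f n).symm

end OreExtension

end Ore

/-! ## Hopf–Ore extensions -/

/-- A Hopf algebra structure on the Ore extension `A[x, σ]` of a Hopf algebra `A` makes it a
Hopf–Ore extension of `A`, with respect to the grouplike element `g` of `A`, when it extends the
Hopf algebra structure of `A` and `Δ(x) = x ⊗ 1 + g ⊗ x`. -/
structure IsHopfOreExtension {k A : Type*} [Field k] [Ring A] [HopfAlgebra k A]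
    (σ : A ≃ₐ[k] A) (g : A) [HopfAlgebra k (OreExtension σ)] : Prop where
  /-- the inclusion of `A` is a homomorphism of bialgebras (so also of Hopf algebras) -/
  exists_bialgHom : ∃ ι : A →ₐc[k] OreExtension σ, ∀ a, ι a = OreExtension.C σ a
  isGroupLikeElem : IsGroupLikeElem k g
  comul_X : Coalgebra.comul (R := k) (OreExtension.X σ) =
    OreExtension.X σ ⊗ₜ[k] (1 : OreExtension σ) + OreExtension.C σ g ⊗ₜ[k] OreExtension.X σ

namespace IsHopfOreExtension

/-- The character `χ : A → k` attached to a Hopf–Ore extension `A[x, σ]`. It is the only character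
with `σ(a) = χ(a₁) a₂` for all `a`, and it also satisfies `σ(a) = g a₁ g⁻¹ χ(a₂)`: see
`eq_character_of_forall`, `apply_eq` and `apply_mul_eq`. -/
def character {k A : Type*} [Field k] [Ring A] [HopfAlgebra k A] (σ : A ≃ₐ[k] A) : A →ₐ[k] k :=
  (Bialgebra.counitAlgHom k A).comp (σ : A →ₐ[k] A)

variable {k A : Type*} [Field k] [Ring A] [HopfAlgebra k A]

theorem eq_character_of_forall (σ : A ≃ₐ[k] A) (χ : A →ₐ[k] k)
    (hχ : ∀ a, σ a = TensorProduct.lid k A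
      (TensorProduct.map χ.toLinearMap LinearMap.id (Coalgebra.comul a))) :
    χ = character σ := by
  ext a
  have h2 : ∀ t : A ⊗[k] A, Coalgebra.counit (R := k) (TensorProduct.lid k A
      (TensorProduct.map χ.toLinearMap LinearMap.id t)) =
      χ (TensorProduct.rid k A (TensorProduct.map LinearMap.id (Coalgebra.counit (R := k)) t)) := by
    intro t
    induction t with
    | zero => simp
    | tmul a b => simp [mul_comm]
    | add s t hs ht => simp only [map_add, hs, ht]
  change χ a = Coalgebra.counit (R := k) (σ a)
  rw [hχ a, h2]
  have h3 := Coalgebra.lTensor_counit_comul (R := k) a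
  rw [LinearMap.lTensor] at h3
  rw [h3]
  simp

/-- The two identities obtained by comparing coefficients in `Δ(x a) = Δ(σ(a) x)`. -/
theorem comul_apply {σ : A ≃ₐ[k] A} {g : A} [HopfAlgebra k (OreExtension σ)]
    (h : IsHopfOreExtension σ g) (a : A) :
    Coalgebra.comul (R := k) (σ a) =
        TensorProduct.map (σ : A →ₐ[k] A).toLinearMap LinearMap.id (Coalgebra.comul (R := k) a) ∧
      Coalgebra.comul (R := k) (σ a) * (g ⊗ₜ[k] (1 : A)) =
        (g ⊗ₜ[k] (1 : A)) *
          TensorProduct.map LinearMap.id (σ : A →ₐ[k] A).toLinearMap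
            (Coalgebra.comul (R := k) a) := by
  obtain ⟨ι, hι⟩ := h.exists_bialgHom
  -- the coefficient functionals are linear
  have hsmul : ∀ (c : k) (p : OreExtension σ),
      c • p = OreExtension.C σ (algebraMap k A c) * p := by
    intro c p
    rw [Algebra.smul_def, ← hι]
    congr 1
    exact (AlgHomClass.commutes ι c).symm
  let co : ℕ → OreExtension σ →ₗ[k] A := fun n =>
    { toFun := OreExtension.coeff σ n
      map_add' := map_add _
      map_smul' := by
        intro c p
        rw [hsmul, OreExtension.coeff_C_mul, RingHom.id_apply, Algebra.smul_def] }
  have co_apply : ∀ n a m, co n (OreExtension.C σ a * OreExtension.X σ ^ m) =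
      if m = n then a else 0 := fun n a m => OreExtension.coeff_C_mul_X_pow σ a m n
  have c0 : ∀ a, co 0 (ι a) = a := fun a => by
    have := co_apply 0 a 0; simpa [hι] using this
  have c1 : ∀ a, co 1 (ι a) = 0 := fun a => by
    have := co_apply 1 a 0; simpa [hι] using this
  have c0X : ∀ a, co 0 (ι a * OreExtension.X σ) = 0 := fun a => by
    have := co_apply 0 a 1; simpa [hι] using this
  have c1X : ∀ a, co 1 (ι a * OreExtension.X σ) = a := fun a => by
    have := co_apply 1 a 1; simpa [hι] using this
  have hX : ∀ a, OreExtension.X σ * ι a = ι (σ a) * OreExtension.X σ := fun a => by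
    rw [hι, hι, OreExtension.X_mul_C]
  have hΔ : ∀ b, Coalgebra.comul (R := k) (ι b) =
      TensorProduct.map ι.toLinearMap ι.toLinearMap (Coalgebra.comul (R := k) b) :=
    fun b => (CoalgHomClass.map_comp_comul_apply ι b).symm
  have hgX := h.comul_X
  rw [← hι g] at hgX
  -- `Δ(x a) = Δ(σ(a) x)`
  have main : (OreExtension.X σ ⊗ₜ[k] (1 : OreExtension σ) + ι g ⊗ₜ[k] OreExtension.X σ) *
      TensorProduct.map ι.toLinearMap ι.toLinearMap (Coalgebra.comul (R := k) a) =
      TensorProduct.map ι.toLinearMap ι.toLinearMap (Coalgebra.comul (R := k) (σ a)) *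
      (OreExtension.X σ ⊗ₜ[k] (1 : OreExtension σ) + ι g ⊗ₜ[k] OreExtension.X σ) := by
    rw [← hΔ, ← hΔ, ← hgX, ← Bialgebra.comul_mul, ← Bialgebra.comul_mul, hX]
  have L1 : ∀ t : A ⊗[k] A, TensorProduct.map (co 1) (co 0)
      ((OreExtension.X σ ⊗ₜ[k] (1 : OreExtension σ) + ι g ⊗ₜ[k] OreExtension.X σ) *
        TensorProduct.map ι.toLinearMap ι.toLinearMap t) =
      TensorProduct.map (σ : A →ₐ[k] A).toLinearMap LinearMap.id t := by
    intro t
    induction t with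
    | zero => simp
    | add s t hs ht => simp only [map_add, mul_add] at hs ht ⊢; rw [hs, ht]
    | tmul a b =>
      simp only [TensorProduct.map_tmul, add_mul, Algebra.TensorProduct.tmul_mul_tmul, map_add]
      change co 1 (OreExtension.X σ * ι a) ⊗ₜ[k] co 0 (1 * ι b) +
        co 1 (ι g * ι a) ⊗ₜ[k] co 0 (OreExtension.X σ * ι b) = σ a ⊗ₜ[k] b
      rw [hX, hX, c1X, one_mul, c0, c0X, TensorProduct.tmul_zero, add_zero]
  have L2 : ∀ t : A ⊗[k] A, TensorProduct.map (co 0) (co 1)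
      ((OreExtension.X σ ⊗ₜ[k] (1 : OreExtension σ) + ι g ⊗ₜ[k] OreExtension.X σ) *
        TensorProduct.map ι.toLinearMap ι.toLinearMap t) =
      (g ⊗ₜ[k] (1 : A)) * TensorProduct.map LinearMap.id (σ : A →ₐ[k] A).toLinearMap t := by
    intro t
    induction t with
    | zero => simp
    | add s t hs ht => simp only [map_add, mul_add] at hs ht ⊢; rw [hs, ht]
    | tmul a b =>
      simp only [TensorProduct.map_tmul, add_mul, Algebra.TensorProduct.tmul_mul_tmul, map_add]
      change co 0 (OreExtension.X σ * ι a) ⊗ₜ[k] co 1 (1 * ι b) +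
        co 0 (ι g * ι a) ⊗ₜ[k] co 1 (OreExtension.X σ * ι b) = (g * a) ⊗ₜ[k] (1 * σ b)
      rw [hX, hX, c1X, one_mul, one_mul, c1, ← map_mul, c0, TensorProduct.tmul_zero, zero_add]
  have R1 : ∀ t : A ⊗[k] A, TensorProduct.map (co 1) (co 0)
      (TensorProduct.map ι.toLinearMap ι.toLinearMap t *
        (OreExtension.X σ ⊗ₜ[k] (1 : OreExtension σ) + ι g ⊗ₜ[k] OreExtension.X σ)) = t := by
    intro t
    induction t with
    | zero => simp
    | add s t hs ht => simp only [map_add, add_mul] at hs ht ⊢; rw [hs, ht]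
    | tmul a b =>
      simp only [TensorProduct.map_tmul, mul_add, Algebra.TensorProduct.tmul_mul_tmul, map_add]
      change co 1 (ι a * OreExtension.X σ) ⊗ₜ[k] co 0 (ι b * 1) +
        co 1 (ι a * ι g) ⊗ₜ[k] co 0 (ι b * OreExtension.X σ) = a ⊗ₜ[k] b
      rw [c1X, mul_one, c0, c0X, TensorProduct.tmul_zero, add_zero]
  have R2 : ∀ t : A ⊗[k] A, TensorProduct.map (co 0) (co 1)
      (TensorProduct.map ι.toLinearMap ι.toLinearMap t *
        (OreExtension.X σ ⊗ₜ[k] (1 : OreExtension σ) + ι g ⊗ₜ[k] OreExtension.X σ)) =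
      t * (g ⊗ₜ[k] (1 : A)) := by
    intro t
    induction t with
    | zero => simp
    | add s t hs ht => simp only [map_add, add_mul] at hs ht ⊢; rw [hs, ht]
    | tmul a b =>
      simp only [TensorProduct.map_tmul, mul_add, Algebra.TensorProduct.tmul_mul_tmul, map_add]
      change co 0 (ι a * OreExtension.X σ) ⊗ₜ[k] co 1 (ι b * 1) +
        co 0 (ι a * ι g) ⊗ₜ[k] co 1 (ι b * OreExtension.X σ) = (a * g) ⊗ₜ[k] (b * 1)
      rw [c0X, mul_one, mul_one, c1X, ← map_mul, c0, TensorProduct.zero_tmul, zero_add]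
  constructor
  · rw [← R1 (Coalgebra.comul (R := k) (σ a)), ← main, L1]
  · rw [← R2 (Coalgebra.comul (R := k) (σ a)), ← main, L2]

/-- `σ(a) = χ(a₁) a₂`. -/
theorem apply_eq {σ : A ≃ₐ[k] A} {g : A} [HopfAlgebra k (OreExtension σ)]
    (h : IsHopfOreExtension σ g) (a : A) :
    σ a = TensorProduct.lid k A
      (TensorProduct.map (character σ).toLinearMap LinearMap.id (Coalgebra.comul a)) := by
  have h1 := congrArg (fun t => TensorProduct.lid k A
    (LinearMap.rTensor A (Coalgebra.counit (R := k)) t)) (h.comul_apply a).1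
  simp only [Coalgebra.rTensor_counit_comul, TensorProduct.lid_tmul, one_smul] at h1
  rw [h1, LinearMap.rTensor, ← LinearMap.comp_apply, ← TensorProduct.map_comp]
  rfl

/-- `σ(a) g = g a₁ χ(a₂)`, that is, `σ(a) = g a₁ g⁻¹ χ(a₂)`. -/
theorem apply_mul_eq {σ : A ≃ₐ[k] A} {g : A} [HopfAlgebra k (OreExtension σ)]
    (h : IsHopfOreExtension σ g) (a : A) :
    σ a * g = g * TensorProduct.rid k A
      (TensorProduct.map LinearMap.id (character σ).toLinearMap (Coalgebra.comul a)) := by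
  have e1 : ∀ t : A ⊗[k] A, TensorProduct.rid k A (LinearMap.lTensor A
      (Coalgebra.counit (R := k)) (t * (g ⊗ₜ[k] (1 : A)))) =
      TensorProduct.rid k A (LinearMap.lTensor A (Coalgebra.counit (R := k)) t) * g := by
    intro t
    induction t with
    | zero => simp
    | add s t hs ht => simp only [map_add, add_mul, hs, ht]
    | tmul a b => simp
  have e2 : ∀ t : A ⊗[k] A, TensorProduct.rid k A (LinearMap.lTensor A
      (Coalgebra.counit (R := k)) ((g ⊗ₜ[k] (1 : A)) *
        TensorProduct.map LinearMap.id (σ : A →ₐ[k] A).toLinearMap t)) =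
      g * TensorProduct.rid k A
        (TensorProduct.map LinearMap.id (character σ).toLinearMap t) := by
    intro t
    induction t with
    | zero => simp
    | add s t hs ht => simp only [map_add, mul_add, hs, ht]
    | tmul a b => simp [character]
  have h1 := congrArg (fun t => TensorProduct.rid k A
    (LinearMap.lTensor A (Coalgebra.counit (R := k)) t)) (h.comul_apply a).2
  simp only [e1, e2] at h1
  rw [← h1, Coalgebra.lTensor_counit_comul]
  simp

end IsHopfOreExtension

/-! ## Partial actions -/

/-- A (left) partial action of a bialgebra `H` on a unital algebra `R`: a bilinear map
`(h, r) ↦ h · r` with `1 · r = r`, `h · (r s) = (h₁ · r)(h₂ · s)` and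
`h · (l · r) = (h₁ · 1)(h₂ l · r)`. -/
structure IsPartialAction {k H R : Type*} [Field k] [Ring H] [Bialgebra k H] [Ring R] [Algebra k R]
    (act : H →ₗ[k] R →ₗ[k] R) : Prop where
  one_act : ∀ r : R, act 1 r = r
  act_mul : ∀ (h : H) (r s : R), act h (r * s) =
    LinearMap.mul' k R (TensorProduct.map (act.flip r) (act.flip s) (Coalgebra.comul h))
  act_act : ∀ (h l : H) (r : R), act h (act l r) =
    LinearMap.mul' k R (TensorProduct.map (act.flip 1) (act.flip r ∘ₗ LinearMap.mulRight k l)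
      (Coalgebra.comul h))

/-! Put `q = χ(g)` and `w = x · 1`. Since `x g = q g x`, the `q`-binomial theorem at a primitive
`d`-th root of unity makes `x ^ d` skew-primitive, so it generates a Hopf ideal. Moreover `x ^ d` is
normal (`OreExtension.exists_mul_X_pow_eq`), so every element of `I` has the form `x ^ d * l`, and
it suffices that `(x ^ d * l) · r = 0`.

If `g · 1 = 1`, then `w = 0` and `x` acts globally: `(x ^ d * l) · r` is the `d`-th iterate of `x ·`
at `l · r`. If `g · 1 = 0`, comparing `x` with `g⁻¹ x` gives `(x l) · r = w (l · r) - (g l · r) w`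
(`act_mul_eq`). Iterating produces a product of factors `L - q⁻ⁱ N` with commuting `L` and `N`,
which collapses to `L ^ d - N ^ d`; hence `(x ^ d l) · r = w ^ d (l · r) - (g ^ d l · r) w ^ d`
(`act_pow_mul_eq`). This vanishes in cases (ii) and (iii). -/

/-! ## Skew-commuting elements and roots of unity -/

section SkewPowers

variable {k B : Type*} [Field k] [Ring B] [Algebra k B]

/-- `∏ i < d, (t - qⁱ s) = t ^ d - s ^ d` for commuting `s`, `t` and `q` a primitive `d`-th root
of unity. -/
theorem IsPrimitiveRoot.prod_range_sub_pow_mul {K : Type*} [CommRing K] [IsDomain K] {q : K}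
    {d : ℕ} (hd : 0 < d) (hq : IsPrimitiveRoot q d) (s t : K) :
    ∏ i ∈ Finset.range d, (t - q ^ i * s) = t ^ d - s ^ d := by
  rw [hq.pow_sub_pow_eq_prod_sub_mul t s hd]
  have : NeZero d := ⟨hd.ne'⟩
  refine Finset.prod_bij (fun i _ => q ^ i) ?_ ?_ ?_ fun _ _ => rfl
  · intro i _
    rw [Polynomial.mem_nthRootsFinset hd, ← pow_mul, mul_comm, pow_mul, hq.pow_eq_one, one_pow]
  · intro i hi j hj h
    exact hq.pow_inj (Finset.mem_range.1 hi) (Finset.mem_range.1 hj) h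
  · intro ζ hζ
    obtain ⟨i, hi, rfl⟩ := hq.eq_pow_of_pow_eq_one ((Polynomial.mem_nthRootsFinset hd _).1 hζ)
    exact ⟨i, Finset.mem_range.2 hi, rfl⟩

open scoped IsMulCommutative in
/-- The product `∏ i < d, (t - qⁱ s)` for commuting elements of a noncommutative algebra, given
by a recursion. -/
theorem IsPrimitiveRoot.eq_pow_sub_pow_of_recursion {q : k} {d : ℕ} (hd : 0 < d)
    (hq : IsPrimitiveRoot q d) {s t : B} (hst : Commute s t) (F : ℕ → B) (h0 : F 0 = 1)
    (hF : ∀ n, F (n + 1) = (t - q ^ n • s) * F n) : F d = t ^ d - s ^ d := by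
  have hcomm : ∀ a ∈ ({s, t} : Set B), ∀ b ∈ ({s, t} : Set B), a * b = b * a := by
    rintro a (rfl | rfl) b (rfl | rfl)
    exacts [rfl, hst.eq, hst.eq.symm, rfl]
  have := Algebra.isMulCommutative_adjoin k hcomm
  let s' : Algebra.adjoin k ({s, t} : Set B) := ⟨s, Algebra.subset_adjoin (by simp)⟩
  let t' : Algebra.adjoin k ({s, t} : Set B) := ⟨t, Algebra.subset_adjoin (by simp)⟩
  -- The factorization needs a domain, which the algebra generated by `s` and `t` need not be. It is
  -- proved for polynomials in two variables and specialized along `ψ`.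
  let φ : MvPolynomial Bool k →ₐ[k] Algebra.adjoin k ({s, t} : Set B) :=
    MvPolynomial.aeval fun b => bif b then t' else s'
  let ψ : MvPolynomial Bool k →+* B := (Algebra.adjoin k ({s, t} : Set B)).val.toRingHom.comp
    φ.toRingHom
  have hψs : ψ (MvPolynomial.X false) = s := by simp [ψ, φ, s']
  have hψt : ψ (MvPolynomial.X true) = t := by simp [ψ, φ, t']
  have hψC : ∀ c : k, ψ (MvPolynomial.C c) = algebraMap k B c := by
    intro c
    have : φ (MvPolynomial.C c) = algebraMap k _ c := MvPolynomial.algHom_C _ _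
    simp only [ψ, RingHom.comp_apply]
    exact congrArg (Subtype.val) this
  have key : ∀ n, F n = ψ (∏ i ∈ Finset.range n, (MvPolynomial.X true -
      MvPolynomial.C q ^ i * MvPolynomial.X false)) := by
    intro n
    induction n with
    | zero => simp [h0]
    | succ n ih =>
      rw [hF, ih, Finset.prod_range_succ, mul_comm (∏ i ∈ _, _), map_mul ψ, map_sub ψ, map_mul ψ,
        map_pow ψ, hψs, hψt, hψC, ← map_pow, ← Algebra.smul_def]
  rw [key, (hq.map_of_injective (MvPolynomial.C_injective Bool k)).prod_range_sub_pow_mul hd,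
    map_sub ψ, map_pow ψ, map_pow ψ, hψs, hψt]

theorem mul_pow_eq_smul_of_mul_eq_smul {q : k} {s p : B} (h : s * p = q • (p * s)) (n : ℕ) :
    s * p ^ n = q ^ n • (p ^ n * s) := by
  induction n with
  | zero => simp
  | succ n ih =>
    rw [pow_succ, ← mul_assoc, ih, smul_mul_assoc, mul_assoc, h, mul_smul_comm, smul_smul,
      ← pow_succ, mul_assoc]

/-- The `q`-binomial theorem at a primitive root of unity, for `p * t` and `p * s` with
`s p = q p s` and `t` commuting with `p` and `s`. -/
theorem IsPrimitiveRoot.mul_sub_pow {q : k} {d : ℕ} (hd : 0 < d) (hq : IsPrimitiveRoot q d)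
    {s t p : B} (hst : Commute s t) (htp : Commute t p) (hsp : s * p = q • (p * s)) :
    (p * (t - s)) ^ d = p ^ d * (t ^ d - s ^ d) := by
  -- For every `n`, `(p (t - s)) ^ n = p ^ n * F n`: moving `t - s` past `p ^ n` turns it into `t -
  -- q ^ n s`. The root of unity only enters in evaluating `F d`.
  let F : ℕ → B := fun n => Nat.rec 1 (fun n b => (t - q ^ n • s) * b) n
  rw [← hq.eq_pow_sub_pow_of_recursion hd hst F rfl fun n => rfl]
  generalize d = n
  induction n with
  | zero => simp [F]
  | succ n ih =>
    have h : (t - s) * p ^ n = p ^ n * (t - q ^ n • s) := by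
      rw [sub_mul, mul_sub, mul_pow_eq_smul_of_mul_eq_smul hsp, (htp.pow_right n).eq,
        mul_smul_comm]
    rw [pow_succ', ih, mul_assoc p, ← mul_assoc (t - s), h, pow_succ', mul_assoc, mul_assoc]

/-- `(u + v) ^ d = u ^ d + v ^ d` for `u = p * t` and `v = p * s` with `s p = q p s`, `t` commuting
with `p` and `s`, and `q` a primitive `d`-th root of unity. -/
theorem IsPrimitiveRoot.mul_add_mul_pow {q : k} {d : ℕ} (hd : 0 < d) (hq : IsPrimitiveRoot q d)
    {s t p : B} (hst : Commute s t) (htp : Commute t p) (hsp : s * p = q • (p * s)) :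
    (p * s + p * t) ^ d = (p * s) ^ d + (p * t) ^ d := by
  have hsp' : (-s) * p = q • (p * -s) := by rw [neg_mul, hsp, mul_neg, smul_neg]
  -- Using `-s` twice, the second time with `t = 0`, identifies `-(p ^ d (-s) ^ d)` with `(p s) ^
  -- d`, so neither the sign `(-1) ^ d` nor `(p s) ^ d` has to be computed.
  have h1 := hq.mul_sub_pow hd hst.neg_left htp hsp'
  have h2 := hq.mul_sub_pow hd (Commute.zero_right (-s)) (Commute.zero_left p) hsp'
  rw [sub_neg_eq_add] at h1 h2
  rw [zero_add, zero_pow hd.ne'] at h2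
  rw [← mul_add, add_comm s t, h1, h2, htp.symm.mul_pow]
  noncomm_ring

end SkewPowers

/-! ## Skew-primitive elements -/

section SkewPrimitive

open Coalgebra

variable {k H : Type*} [Field k] [Ring H] [HopfAlgebra k H]

/-- If `x` is `(1, g)`-skew-primitive and `x g = q g x`, then `x ^ d` is `(1, g ^ d)`-skew-primitive
for `q` a primitive `d`-th root of unity. -/
theorem comul_pow_of_skewPrimitive {q : k} {d : ℕ} (hd : 0 < d) (hq : IsPrimitiveRoot q d)
    {g x : H} (hg : IsGroupLikeElem k g) (hx : comul (R := k) x = x ⊗ₜ[k] 1 + g ⊗ₜ[k] x)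
    (hxg : x * g = q • (g * x)) :
    comul (R := k) (x ^ d) = (x ^ d) ⊗ₜ[k] 1 + (g ^ d) ⊗ₜ[k] (x ^ d) := by
  let g' := HopfAlgebra.antipode k g
  have h1 : g * g' = 1 := hg.mul_antipode_cancel
  have h2 : g' * g = 1 := hg.antipode_mul_cancel
  -- Chosen so that `p s = x ⊗ 1` and `p t = g ⊗ x` are the two terms of `Δ(x)`.
  have key := hq.mul_add_mul_pow (B := H ⊗[k] H) hd (s := (g' * x) ⊗ₜ[k] 1)
    (t := (1 : H) ⊗ₜ[k] x) (p := g ⊗ₜ[k] 1) (by simp [Commute, SemiconjBy])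
    (by simp [Commute, SemiconjBy]) (by
      rw [Algebra.TensorProduct.tmul_mul_tmul, Algebra.TensorProduct.tmul_mul_tmul, mul_assoc, hxg,
        mul_smul_comm, ← mul_assoc, ← mul_assoc, h1, h2, TensorProduct.smul_tmul'])
  simp only [Algebra.TensorProduct.tmul_mul_tmul, mul_one, one_mul, ← mul_assoc, h1,
    Algebra.TensorProduct.tmul_pow, one_pow] at key
  rw [Bialgebra.comul_pow, hx, key]

theorem counit_eq_zero_of_skewPrimitive {g y : H} (hg : IsGroupLikeElem k g)
    (hy : comul (R := k) y = y ⊗ₜ[k] 1 + g ⊗ₜ[k] y) : counit (R := k) y = 0 := by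
  have h := Coalgebra.rTensor_counit_comul (R := k) y
  rw [hy] at h
  have h' := congrArg (fun t => counit (R := k) (TensorProduct.lid k H t)) h
  simpa [hg.counit_eq_one] using h'

/-- The antipode axiom `S(y₁) y₂ = ε(y)` reads `S(y) + S(g) y = 0`. -/
theorem antipode_of_skewPrimitive {g y : H} (hg : IsGroupLikeElem k g)
    (hy : comul (R := k) y = y ⊗ₜ[k] 1 + g ⊗ₜ[k] y) :
    HopfAlgebra.antipode k y = -(HopfAlgebra.antipode k g * y) := by
  have h := HopfAlgebra.mul_antipode_rTensor_comul_apply (R := k) y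
  rw [hy, counit_eq_zero_of_skewPrimitive hg hy] at h
  simp only [map_add, LinearMap.rTensor_tmul, LinearMap.mul'_apply, mul_one, map_zero] at h
  exact eq_neg_of_add_eq_zero_left h

/-- Reduces the counit and comultiplication conditions for a Hopf ideal, both multiplicative, to its
generator. -/
theorem TwoSidedIdeal.map_eq_zero_of_mem_span_singleton {B S : Type*} [Ring B] [Ring S]
    (f : B →+* S) {y : B} (hf : f y = 0) {h : B} (hh : h ∈ TwoSidedIdeal.span {y}) : f h = 0 := by
  have hle : TwoSidedIdeal.span {y} ≤ TwoSidedIdeal.ker f :=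
    TwoSidedIdeal.span_le.2 (by
      rintro _ rfl
      exact (TwoSidedIdeal.mem_ker f).2 hf)
  exact (TwoSidedIdeal.mem_ker f).1 (hle hh)

/-- The two-sided ideal generated by a skew-primitive element is a Hopf ideal. -/
theorem isHopfIdeal_span_of_skewPrimitive {g y : H} (hg : IsGroupLikeElem k g)
    (hy : comul (R := k) y = y ⊗ₜ[k] 1 + g ⊗ₜ[k] y) :
    (TwoSidedIdeal.span {y}).asIdeal.IsHopfIdeal k := by
  set I : Ideal H := (TwoSidedIdeal.span {y}).asIdeal with hI
  have hyI : y ∈ I := TwoSidedIdeal.mem_asIdeal.2 (TwoSidedIdeal.subset_span rfl)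
  refine { counit_eq_zero := ?_, map_mkQ_comul_eq_zero := ?_, antipode_mem := ?_ }
  · exact fun h hh => TwoSidedIdeal.map_eq_zero_of_mem_span_singleton
      (Bialgebra.counitAlgHom k H).toRingHom (counit_eq_zero_of_skewPrimitive hg hy)
      (TwoSidedIdeal.mem_asIdeal.1 hh)
  · intro h hh
    have hmk : Ideal.Quotient.mkₐ k I y = 0 := Ideal.Quotient.eq_zero_iff_mem.2 hyI
    refine TwoSidedIdeal.map_eq_zero_of_mem_span_singleton ((Algebra.TensorProduct.map (Ideal.Quotient.mkₐ k I)
      (Ideal.Quotient.mkₐ k I)).comp (Bialgebra.comulAlgHom k H)).toRingHom ?_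
      (TwoSidedIdeal.mem_asIdeal.1 hh)
    change Algebra.TensorProduct.map (Ideal.Quotient.mkₐ k I) (Ideal.Quotient.mkₐ k I)
      (comul (R := k) y) = 0
    rw [hy, map_add, Algebra.TensorProduct.map_tmul, Algebra.TensorProduct.map_tmul, hmk,
      TensorProduct.zero_tmul, TensorProduct.tmul_zero, add_zero]
  -- The antipode is antimultiplicative, hence no ring homomorphism to the same ring: left and right
  -- multiples are exchanged in an induction over the ideal.
  · intro h hh
    have hh' := TwoSidedIdeal.mem_asIdeal.1 hh
    clear hh
    induction hh' using TwoSidedIdeal.span_induction with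
    | mem z hz =>
      obtain rfl := hz
      rw [antipode_of_skewPrimitive hg hy]
      exact neg_mem (I.mul_mem_left _ hyI)
    | zero => rw [map_zero]; exact zero_mem I
    | add a b _ _ ha hb => rw [map_add]; exact add_mem ha hb
    | neg a _ ha => rw [map_neg]; exact neg_mem ha
    | left_absorb a z _ hz =>
      rw [HopfAlgebra.antipode_mul_antidistrib]
      exact I.mul_mem_right _ hz
    | right_absorb b z _ hz =>
      rw [HopfAlgebra.antipode_mul_antidistrib]
      exact I.mul_mem_left _ hz

end SkewPrimitive

/-! ## Partial actions and skew-primitive elements -/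

namespace IsPartialAction

open Coalgebra

/-! ### Grouplike and skew-primitive elements in a partial action -/

section Bialgebra

variable {k H R : Type*} [Field k] [Ring H] [Bialgebra k H] [Ring R] [Algebra k R]
  {act : H →ₗ[k] R →ₗ[k] R} {g g' x : H}

theorem act_act_of_isGroupLikeElem (h : IsPartialAction act) (hg : IsGroupLikeElem k g) (l : H)
    (r : R) : act g (act l r) = act g 1 * act (g * l) r := by
  rw [h.act_act, hg.comul_eq_tmul_self]
  simp

/-- The right factor `g'` is kept general so that both `x` and `g⁻¹ x` are covered. -/
theorem act_act_of_comul (h : IsPartialAction act)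
    (hx : comul (R := k) x = x ⊗ₜ[k] g' + g ⊗ₜ[k] x) (l : H) (r : R) :
    act x (act l r) = act x 1 * act (g' * l) r + act g 1 * act (x * l) r := by
  rw [h.act_act, hx]
  simp

theorem act_eq_of_comul (h : IsPartialAction act)
    (hx : comul (R := k) x = x ⊗ₜ[k] g' + g ⊗ₜ[k] x) (r : R) :
    act x r = act x r * act g' 1 + act g r * act x 1 := by
  conv_lhs => rw [← mul_one r, h.act_mul, hx]
  simp

/-- Expanding `g' · (g · 1)` gives `(g' · 1)(g' g · 1) = g' · 1`. -/
theorem act_inv_one_eq_zero (h : IsPartialAction act) (hg' : IsGroupLikeElem k g')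
    (hgg : g' * g = 1) (hg1 : act g 1 = 0) : act g' 1 = 0 := by
  have := h.act_act_of_isGroupLikeElem hg' g 1
  rwa [hg1, map_zero, hgg, h.one_act, mul_one, eq_comm] at this

/-- If `g · 1 = 1`, then a `(1, g)`-skew-primitive element acts globally. -/
theorem act_pow_mul (h : IsPartialAction act) (hg1 : act g 1 = 1)
    (hx : comul (R := k) x = x ⊗ₜ[k] 1 + g ⊗ₜ[k] x) (n : ℕ) (l : H) (r : R) :
    act (x ^ n * l) r = (act x ^ n) (act l r) := by
  have hx1 : act x 1 = 0 := by
    have := h.act_eq_of_comul hx 1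
    rw [h.one_act, hg1, mul_one, one_mul] at this
    simpa using this
  induction n with
  | zero => simp
  | succ n ih =>
    rw [pow_succ', pow_succ', Module.End.mul_apply, ← ih, h.act_act_of_comul hx, hx1, hg1,
      zero_mul, zero_add, one_mul, mul_assoc]

end Bialgebra

/-! ### Powers of a skew-primitive element, and descent to the quotient -/

section Hopf

variable {k H R : Type*} [Field k] [Ring H] [HopfAlgebra k H] [Ring R] [Algebra k R]
  {act : H →ₗ[k] R →ₗ[k] R} {g x : H} {q : k}

/-- If `g · 1 = 0`, then a `(1, g)`-skew-primitive element `x` acts as a twisted inner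
derivation. -/
theorem act_mul_eq (h : IsPartialAction act) (hg : IsGroupLikeElem k g) (hg1 : act g 1 = 0)
    (hq : q ≠ 0) (hx : comul (R := k) x = x ⊗ₜ[k] 1 + g ⊗ₜ[k] x) (hxg : x * g = q • (g * x))
    (l : H) (r : R) : act (x * l) r = act x 1 * act l r - act (g * l) r * act x 1 := by
  set g' := HopfAlgebra.antipode k g
  have h1 : g * g' = 1 := hg.mul_antipode_cancel
  have h2 : g' * g = 1 := hg.antipode_mul_cancel
  have hg' : IsGroupLikeElem k g' := hg.antipode
  -- For `z = g⁻¹ x`, the vanishing of `g⁻¹ · 1` gives `z · r = r (z · 1)`, while `z g = q x`.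
  -- Computing `z · (g l · r)` in two ways, with `z · 1 = -q (x · 1)`, yields the formula.
  have hz : comul (R := k) (g' * x) = (g' * x) ⊗ₜ[k] g' + (1 : H) ⊗ₜ[k] (g' * x) := by
    rw [Bialgebra.comul_mul, hx, hg'.comul_eq_tmul_self, mul_add,
      Algebra.TensorProduct.tmul_mul_tmul, Algebra.TensorProduct.tmul_mul_tmul, mul_one, h2]
  have hg'1 := h.act_inv_one_eq_zero hg' h2 hg1
  have hzg : g' * x * g = q • x := by
    rw [mul_assoc, hxg, mul_smul_comm, ← mul_assoc, h2, one_mul]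
  have hxr : ∀ r, act x r = act x 1 * r := fun r => by
    have := h.act_act_of_comul hx 1 r
    rwa [h.one_act, hg1, zero_mul, add_zero, mul_one, h.one_act] at this
  have hzr : ∀ r, act (g' * x) r = r * act (g' * x) 1 := fun r => by
    have := h.act_eq_of_comul hz r
    rwa [hg'1, mul_zero, zero_add, h.one_act] at this
  have hzl := fun l r => h.act_act_of_comul hz (g * l) r
  simp only [← mul_assoc, h2, hzg, one_mul, h.one_act, smul_mul_assoc, map_smul,
    LinearMap.smul_apply] at hzl
  have hz1 : act (g' * x) 1 = -(q • act x 1) := by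
    have := hzl 1 1
    rw [mul_one, mul_one, h.one_act, hg1, map_zero, mul_one] at this
    exact eq_neg_of_add_eq_zero_left this.symm
  have h3 := hzl l r
  rw [hzr, hz1] at h3
  apply smul_right_injective R hq
  simp only [smul_sub]
  simp only [mul_neg, neg_mul, mul_smul_comm, smul_mul_assoc] at h3
  linear_combination (norm := module) (-1 : k) • h3

/-- The powers of a `(1, g)`-skew-primitive element `x` when `g · 1 = 0` and `x g = q g x`, with
`q` a primitive root of unity. -/
theorem act_pow_mul_eq (h : IsPartialAction act) (hg : IsGroupLikeElem k g) (hg1 : act g 1 = 0)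
    {d : ℕ} (hd : 0 < d) (hq : IsPrimitiveRoot q d)
    (hx : comul (R := k) x = x ⊗ₜ[k] 1 + g ⊗ₜ[k] x) (hxg : x * g = q • (g * x))
    (l : H) (r : R) :
    act (x ^ d * l) r = act x 1 ^ d * act l r - act (g ^ d * l) r * act x 1 ^ d := by
  have hq0 : q ≠ 0 := hq.ne_zero hd.ne'
  have hgx : g * x = q⁻¹ • (x * g) := by rw [hxg, smul_smul, inv_mul_cancel₀ hq0, one_smul]
  -- The operators live on maps `H → R`, not on `R`, because `g l · r` is not a function of `l · r`
  -- in general.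
  let L : Module.End k (H →ₗ[k] R) :=
    LinearMap.llcomp k H R R (LinearMap.mulLeft k (act x 1))
  let N : Module.End k (H →ₗ[k] R) :=
    LinearMap.llcomp k H R R (LinearMap.mulRight k (act x 1)) ∘ₗ
      LinearMap.lcomp k R (LinearMap.mulLeft k g)
  have hL : ∀ f l, L f l = act x 1 * f l := fun _ _ => rfl
  have hN : ∀ f l, N f l = f (g * l) * act x 1 := fun _ _ => rfl
  have hcomm : Commute N L := by
    ext f l
    simp [hL, hN, mul_assoc]
  let F : ℕ → Module.End k (H →ₗ[k] R) :=
    fun n => Nat.rec 1 (fun n b => (L - q⁻¹ ^ n • N) * b) n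
  have hF : ∀ n, F (n + 1) = (L - q⁻¹ ^ n • N) * F n := fun n => rfl
  -- The factor `q⁻¹ ^ n` comes from `g x ^ n = q⁻¹ ^ n x ^ n g`.
  have key : ∀ n l, act (x ^ n * l) r = F n (act.flip r) l := by
    intro n
    induction n with
    | zero => intro l; simp [F]
    | succ n ih =>
      intro l
      rw [pow_succ', mul_assoc, h.act_mul_eq hg hg1 hq0 hx hxg, hF, Module.End.mul_apply,
        LinearMap.sub_apply, LinearMap.sub_apply, LinearMap.smul_apply, LinearMap.smul_apply,
        hL, hN, ← ih, ← ih, ← mul_assoc g, mul_pow_eq_smul_of_mul_eq_smul hgx, smul_mul_assoc,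
        mul_assoc, map_smul, LinearMap.smul_apply, smul_mul_assoc]
  have hLn : ∀ n f l, (L ^ n) f l = act x 1 ^ n * f l := by
    intro n
    induction n with
    | zero => simp
    | succ n ih => intro f l; rw [pow_succ', Module.End.mul_apply, hL, ih, pow_succ', mul_assoc]
  have hNn : ∀ n f l, (N ^ n) f l = f (g ^ n * l) * act x 1 ^ n := by
    intro n
    induction n with
    | zero => simp
    | succ n ih =>
      intro f l
      rw [pow_succ', Module.End.mul_apply, hN, ih, ← mul_assoc, ← pow_succ, pow_succ (act x 1),
        mul_assoc]
  rw [key, hq.inv.eq_pow_sub_pow_of_recursion hd hcomm F rfl hF, LinearMap.sub_apply,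
    LinearMap.sub_apply, hLn, hNn]
  rfl

/-- The three cases in which `x ^ d`, and so the right ideal that it generates, acts by zero. -/
theorem act_pow_mul_eq_zero (h : IsPartialAction act) (hg : IsGroupLikeElem k g)
    {d : ℕ} (hd : 0 < d) (hq : IsPrimitiveRoot q d)
    (hx : comul (R := k) x = x ⊗ₜ[k] 1 + g ⊗ₜ[k] x) (hxg : x * g = q • (g * x))
    (hcases : (act g 1 = 1 ∧ act x ^ d = 0) ∨ (act g 1 = 0 ∧ act x 1 = 0) ∨
      (act g 1 = 0 ∧ act (g ^ d) 1 = 1 ∧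
        ∀ r : R, act x 1 ^ d * r = act (g ^ d) r * act x 1 ^ d))
    (l : H) (r : R) : act (x ^ d * l) r = 0 := by
  rcases hcases with ⟨hg1, hxd⟩ | ⟨hg1, hx1⟩ | ⟨hg1, hgd, hw⟩
  · rw [h.act_pow_mul hg1 hx, hxd, LinearMap.zero_apply]
  · rw [h.act_pow_mul_eq hg hg1 hd hq hx hxg, hx1, zero_pow hd.ne', zero_mul, mul_zero, sub_zero]
  -- As `g ^ d · 1 = 1`, the element `g ^ d` acts globally: `g ^ d · (l · r) = g ^ d l · r`, so the
  -- two terms cancel.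
  · rw [h.act_pow_mul_eq hg hg1 hd hq hx hxg, hw, h.act_act_of_isGroupLikeElem hg.pow, hgd,
      one_mul, sub_self]

/-- A partial action that vanishes on a Hopf ideal descends to the quotient. -/
theorem exists_quotient (h : IsPartialAction act) (I : Ideal H) [I.IsTwoSided] [I.IsHopfIdeal k]
    (hI : ∀ a ∈ I, ∀ r : R, act a r = 0) :
    ∃ act' : (H ⧸ I) →ₗ[k] R →ₗ[k] R, IsPartialAction act' ∧
      ∀ (a : H) (r : R), act' (Ideal.Quotient.mk I a) r = act a r := by
  let act' : (H ⧸ I) →ₗ[k] R →ₗ[k] R := (I.restrictScalars k).liftQ act fun a ha =>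
    LinearMap.ext (hI a ha)
  have hmk : ∀ (a : H) (r : R), act' (Ideal.Quotient.mk I a) r = act a r := fun _ _ => rfl
  have hflip : ∀ r : R, act'.flip r ∘ₗ (Ideal.Quotient.mkₐ k I).toLinearMap = act.flip r :=
    fun _ => rfl
  refine ⟨act', ⟨fun r => ?_, fun a r s => ?_, fun a l r => ?_⟩, hmk⟩
  · rw [← map_one (Ideal.Quotient.mk I), hmk, h.one_act]
  · obtain ⟨a, rfl⟩ := Ideal.Quotient.mk_surjective a
    rw [hmk, h.act_mul, Bialgebra.Quotient.comul_mk, TensorProduct.map_map, hflip, hflip]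
  · obtain ⟨a, rfl⟩ := Ideal.Quotient.mk_surjective a
    obtain ⟨l, rfl⟩ := Ideal.Quotient.mk_surjective l
    rw [hmk, hmk, h.act_act, Bialgebra.Quotient.comul_mk, TensorProduct.map_map, hflip]
    rfl

end Hopf

end IsPartialAction

/-! ## Hopf–Ore extensions -/

section HopfOre

variable {k A : Type*} [Field k] [Ring A]

theorem OreExtension.X_pow_mul_C [Algebra k A] (σ : A ≃ₐ[k] A) (n : ℕ) (a : A) :
    X σ ^ n * C σ a = C σ ((σ ^ n) a) * X σ ^ n := by
  induction n generalizing a with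
  | zero => simp
  | succ n ih =>
    rw [pow_succ, mul_assoc, X_mul_C, ← mul_assoc, ih, mul_assoc, pow_succ]
    rfl

/-- The left ideal generated by `x ^ d` is contained in the right ideal generated by `x ^ d`. -/
theorem OreExtension.exists_mul_X_pow_eq [Algebra k A] (σ : A ≃ₐ[k] A) (d : ℕ)
    (h : OreExtension σ) : ∃ l, h * X σ ^ d = X σ ^ d * l := by
  obtain ⟨f, rfl, -⟩ := OreExtension.existsUnique_sum σ h
  -- Untwisting the coefficients by `σ ^ d` compensates for `x ^ d a = σ ^ d (a) x ^ d`.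
  refine ⟨f.sum fun n a => C σ ((σ ^ d).symm a) * X σ ^ n, ?_⟩
  rw [Finsupp.sum, Finsupp.sum, Finset.sum_mul, Finset.mul_sum]
  refine Finset.sum_congr rfl fun n _ => ?_
  rw [← mul_assoc, X_pow_mul_C, AlgEquiv.apply_symm_apply, mul_assoc, mul_assoc, ← pow_add,
    ← pow_add, add_comm]

variable [HopfAlgebra k A] {σ : A ≃ₐ[k] A} {g : A} [HopfAlgebra k (OreExtension σ)]

namespace IsHopfOreExtension

theorem isGroupLikeElem_C (h : IsHopfOreExtension σ g) :
    IsGroupLikeElem k (OreExtension.C σ g) := by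
  obtain ⟨ι, hι⟩ := h.exists_bialgHom
  rw [← hι]
  exact h.isGroupLikeElem.map ι

/-- `x g = χ(g) g x`. -/
theorem X_mul_C_self (h : IsHopfOreExtension σ g) :
    OreExtension.X σ * OreExtension.C σ g =
      character σ g • (OreExtension.C σ g * OreExtension.X σ) := by
  obtain ⟨ι, hι⟩ := h.exists_bialgHom
  have hσ : σ g = character σ g • g := by
    rw [h.apply_eq, h.isGroupLikeElem.comul_eq_tmul_self]
    simp
  rw [OreExtension.X_mul_C, hσ, ← hι, map_smul, hι, smul_mul_assoc]

end IsHopfOreExtension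

end HopfOre

/-! ### Main theorem -/

theorem mainTheorem6 {k A R : Type*} [Field k] [IsAlgClosed k] [CharZero k]
    [Ring A] [HopfAlgebra k A] (σ : A ≃ₐ[k] A) (g : A)
    [HopfAlgebra k (OreExtension σ)] (hA : IsHopfOreExtension σ g)
    (d : ℕ) (hd : 0 < d) (hq : IsPrimitiveRoot (IsHopfOreExtension.character σ g) d)
    [Ring R] [Algebra k R]
    (act : OreExtension σ →ₗ[k] R →ₗ[k] R) (hact : IsPartialAction act)
    (hcases :
      (act (OreExtension.C σ g) 1 = 1 ∧ act (OreExtension.X σ) ^ d = 0) ∨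
      (act (OreExtension.C σ g) 1 = 0 ∧ act (OreExtension.X σ) 1 = 0) ∨
      (act (OreExtension.C σ g) 1 = 0 ∧ act (OreExtension.C σ g ^ d) 1 = 1 ∧
        ∀ r : R, (act (OreExtension.X σ) 1) ^ d * r =
          act (OreExtension.C σ g ^ d) r * (act (OreExtension.X σ) 1) ^ d)) :
    let I : Ideal (OreExtension σ) := (TwoSidedIdeal.span {OreExtension.X σ ^ d}).asIdeal
    (∀ h ∈ I, ∀ r : R, act h r = 0) ∧
      ∃ _ : I.IsHopfIdeal k, ∃ act' : (OreExtension σ ⧸ I) →ₗ[k] R →ₗ[k] R,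
        IsPartialAction act' ∧ ∀ (h : OreExtension σ) (r : R),
          act' (Ideal.Quotient.mk I h) r = act h r := by
  intro I
  have hg := hA.isGroupLikeElem_C
  have hxg := hA.X_mul_C_self
  have hy := comul_pow_of_skewPrimitive hd hq hg hA.comul_X hxg
  have hkill : ∀ h ∈ I, ∀ r : R, act h r = 0 := by
    intro h hh r
    -- The right ideal `x ^ d A[x, σ]` is already two-sided; only closure under left multiplication
    -- uses normality of `x ^ d`.
    have hl : ∃ l, h = OreExtension.X σ ^ d * l := by
      have hh' := TwoSidedIdeal.mem_asIdeal.1 hh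
      clear hh
      induction hh' using TwoSidedIdeal.span_induction with
      | mem z hz => exact ⟨1, by rw [mul_one]; exact hz⟩
      | zero => exact ⟨0, (mul_zero _).symm⟩
      | add a b _ _ ha hb =>
        obtain ⟨l, rfl⟩ := ha
        obtain ⟨m, rfl⟩ := hb
        exact ⟨l + m, (mul_add _ _ _).symm⟩
      | neg a _ ha =>
        obtain ⟨l, rfl⟩ := ha
        exact ⟨-l, (mul_neg _ _).symm⟩
      | left_absorb a z _ hz =>
        obtain ⟨l, rfl⟩ := hz
        obtain ⟨m, hm⟩ := OreExtension.exists_mul_X_pow_eq σ d a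
        exact ⟨m * l, by rw [← mul_assoc, hm, mul_assoc]⟩
      | right_absorb b z _ hz =>
        obtain ⟨l, rfl⟩ := hz
        exact ⟨l * b, mul_assoc _ _ _⟩
    obtain ⟨l, rfl⟩ := hl
    exact hact.act_pow_mul_eq_zero hg hd hq hA.comul_X hxg hcases l r
  have hHopf : I.IsHopfIdeal k := isHopfIdeal_span_of_skewPrimitive hg.pow hy
  exact ⟨hkill, hHopf, hact.exists_quotient I hkill⟩
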